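/- **Setting.** Fix an integer $d\ge 2$. For finite $\Lambda\subset\mathbb Z$ let $\mathcal A_\Lambda=\bigotimes_{z\in\Lambda}M_d(\mathbb C)$, and let $\mathcal A$, $\mathcal A_L$, $\mathcal A_R$ be the $C^*$-inductive limits of the $\mathcal A_\Lambda$ over all finite $\Lambda\subset\mathbb Z$, $\Lambda\subset(-\infty,-1]$, $\Lambda\subset[0,\infty)$ respectively, so that $\mathcal A=\mathcal A_L\otimes\mathcal A_R$. For $Q\in M_d(\mathbb C)$ and $j\in\mathbb Z$ let $Q^{(j)}\in\mathcal A$ be $Q$ at the site $j$. Let $\gamma$ be the $*$-automorphism of $\mathcal A$ with $\gamma(Q^{(j)})=Q^{(-j-1)}$ for all $Q$ and $j$, and let $\gamma_{L\to R}:\mathcal A_L\to\mathcal A_R$ be the $*$-isomorphism with $\gamma(B\otimes 1)=1\otimes\gamma_{L\to R}(B)$. A pure state $\omega$ on $\mathcal A$ is *reflection invariant* if $\omega\circ\gamma=\omega$. It has the *split property* if $\pi(\mathcal A_R)''$ is a type I factor, where $\pi$ is the GNS representation of $\omega|_{\mathcal A_R}$. Let $\omega$ be a reflection-invariant pure state on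 $\mathcal A$ with the split property. A *reflection-split representation* of $\omega$ is a quadruple $(\mathcal H,\pi,\Omega,\Gamma)$ in which $\pi$ is an irreducible representation of $\mathcal A_R$ on the Hilbert space $\mathcal H$, $\Omega$ is a unit vector of $\mathcal H\otimes\mathcal H$, the triple $(\mathcal H\otimes\mathcal H,\hat\pi,\Omega)$ with $\hat\pi:=(\pi\circ\gamma_{L\to R})\otimes\pi$ is a GNS triple of $\omega$, and $\Gamma$ is the unitary on $\mathcal H\otimes\mathcal H$ with $\Gamma\hat\pi(A)\Omega=\hat\pi(\gamma(A))\Omega$ for all $A\in\mathcal A$. **Theorem.** Let $\omega$ be a reflection-invariant pure state on $\mathcal A$ with the split property, and let $(\mathcal H_\omega,\pi_\omega,\Omega_\omega,\Gamma_\omega)$ be a reflection-split representation of $\omega$. Then $$\Gamma_\omega(1\otimes x)\Gamma_\omega^*=x\otimes 1\qquad\text{for all }x\in B(\mathcal H_\omega).$$ Moreover there is a unique sign $\sigma_\omega\in\{1,-1\}$ such that $$\Gamma_\omega(\xi\otimes\eta)=\sigma_\omega\,\eta\otimes\xi\qquad\text{for all }\xi,\eta\in\mathcal H_\omega.$$ This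 sign does not depend on the choice of the reflection-split representation of $\omega$: any two such representations have the same sign. It is called the $\mathbb Z_2$-index of $\omega$. -/

import Mathlib

universe u v

open scoped ComplexOrder TensorProduct

noncomputable section

namespace SpinChain

/-! ### The Hilbert space on which the observables are realised -/

/-- Classical configurations of the chain: at every site one of the `d` basis vectors of `ℂ^d`. -/
abbrev Config (d : ℕ) : Type := ℤ → Fin d

/-- The Hilbert space `ℓ²(Config d)`. Its standard basis vector at a configuration `s` plays the
role of the infinite product vector `⊗_j ψ_{s j}`. The local observables act on it faithfully. -/
abbrev ChainSpace (d : ℕ) : Type := lp (fun _ : Config d => ℂ) 2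

/-- Bounded operators on `ChainSpace d`. -/
abbrev ChainOp (d : ℕ) : Type := ChainSpace d →L[ℂ] ChainSpace d

variable {d : ℕ}

theorem pullback_sum_le (P : Config d → Prop) [DecidablePred P] (f : Config d → Config d)
    (hf : Set.InjOn f {s | P s}) (ψ : ChainSpace d) (F : Finset (Config d)) :
    ∑ s ∈ F, ‖(if P s then ψ (f s) else 0 : ℂ)‖ ^ (2 : ENNReal).toReal
      ≤ ‖ψ‖ ^ (2 : ENNReal).toReal := by
  classical
  have h0 : ∀ s, ‖(if P s then ψ (f s) else 0 : ℂ)‖ ^ (2 : ENNReal).toReal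
      = if P s then ‖ψ (f s)‖ ^ (2 : ENNReal).toReal else 0 := by
    intro s
    split_ifs <;> simp
  simp_rw [h0]
  rw [← Finset.sum_filter]
  have hinj : Set.InjOn f (F.filter P : Set (Config d)) := by
    intro a ha b hb hab
    simp only [Finset.coe_filter, Set.mem_ofPred_eq] at ha hb
    exact hf ha.2 hb.2 hab
  rw [← Finset.sum_image (f := fun t => ‖ψ t‖ ^ (2 : ENNReal).toReal) hinj]
  exact lp.sum_rpow_le_norm_rpow (by simp) ψ _

/-- The contraction `(T ψ)(s) = ψ (f s)` if `P s`, and `0` otherwise, for `f` injective on `P`. -/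
def pullbackOp (P : Config d → Prop) [DecidablePred P] (f : Config d → Config d)
    (hf : Set.InjOn f {s | P s}) : ChainOp d :=
  LinearMap.mkContinuous
    { toFun := fun ψ => ⟨fun s => if P s then ψ (f s) else 0,
        memℓp_gen' (pullback_sum_le P f hf ψ)⟩
      map_add' := by
        intro ψ φ
        ext s
        change (if P s then (ψ + φ : ChainSpace d) (f s) else 0 : ℂ)
          = (if P s then ψ (f s) else 0) + (if P s then φ (f s) else 0)
        by_cases h : P s <;> simp [h]
      map_smul' := by
        intro c ψ
        ext s
        change (if P s then (c • ψ : ChainSpace d) (f s) else 0 : ℂ)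
          = c * (if P s then ψ (f s) else 0)
        by_cases h : P s <;> simp [h] } 1 (by
    intro ψ
    rw [one_mul]
    exact lp.norm_le_of_forall_sum_le (by simp) (norm_nonneg _) (pullback_sum_le P f hf ψ))

theorem pullbackOp_apply (P : Config d → Prop) [DecidablePred P] (f : Config d → Config d)
    (hf : Set.InjOn f {s | P s}) (ψ : ChainSpace d) (s : Config d) :
    (pullbackOp P f hf ψ : Config d → ℂ) s = if P s then ψ (f s) else 0 := rfl

/-! ### Local algebras -/

/-- The restriction of a configuration to the finite region `Λ`. -/
def restr (Λ : Finset ℤ) (s : Config d) : Λ → Fin d := fun j => s j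

/-- The configuration which is `b` inside `Λ` and `s` outside `Λ`. -/
def overwrite (Λ : Finset ℤ) (s : Config d) (b : Λ → Fin d) : Config d :=
  fun j => if h : j ∈ Λ then b ⟨j, h⟩ else s j

theorem restr_overwrite (Λ : Finset ℤ) (s : Config d) (b : Λ → Fin d) :
    restr Λ (overwrite Λ s b) = b := by
  funext j
  simp [restr, overwrite]

theorem overwrite_overwrite (Λ : Finset ℤ) (s : Config d) (b c : Λ → Fin d) :
    overwrite Λ (overwrite Λ s b) c = overwrite Λ s c := by
  funext j
  by_cases h : j ∈ Λ <;> simp [overwrite, h]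

theorem overwrite_restr (Λ : Finset ℤ) (s : Config d) : overwrite Λ s (restr Λ s) = s := by
  funext j
  by_cases h : j ∈ Λ <;> simp [overwrite, restr, h]

theorem overwrite_injOn (Λ : Finset ℤ) (a b : Λ → Fin d) :
    Set.InjOn (fun s : Config d => overwrite Λ s b) {s | restr Λ s = a} := by
  intro s hs t ht hst
  simp only [Set.mem_ofPred_eq] at hs ht
  have h := congrArg (fun u => overwrite Λ u a) hst
  simp only [overwrite_overwrite] at h
  rw [← overwrite_restr Λ s, ← overwrite_restr Λ t, hs, ht]
  exact h

/-- The matrix unit `|a⟩⟨b| ⊗ 𝟙` of the region `Λ`. -/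
def matrixUnit (Λ : Finset ℤ) (a b : Λ → Fin d) : ChainOp d :=
  pullbackOp (fun s => restr Λ s = a) (fun s => overwrite Λ s b) (overwrite_injOn Λ a b)

/-- The linear map `M ↦ M ⊗ 𝟙`. -/
def localLin (Λ : Finset ℤ) : Matrix (Λ → Fin d) (Λ → Fin d) ℂ →ₗ[ℂ] ChainOp d where
  toFun M := ∑ a, ∑ b, M a b • matrixUnit Λ a b
  map_add' M N := by simp [add_smul, Finset.sum_add_distrib]
  map_smul' c M := by simp [mul_smul, Finset.smul_sum]

theorem localLin_apply (Λ : Finset ℤ) (M : Matrix (Λ → Fin d) (Λ → Fin d) ℂ)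
    (ψ : ChainSpace d) (s : Config d) :
    (localLin Λ M ψ : Config d → ℂ) s = ∑ b, M (restr Λ s) b * ψ (overwrite Λ s b) := by
  have h : ∀ a b, (matrixUnit Λ a b ψ : Config d → ℂ) s =
      if restr Λ s = a then ψ (overwrite Λ s b) else 0 := fun a b => rfl
  simp only [localLin, LinearMap.coe_mk, AddHom.coe_mk, sum_apply,
    smul_apply, lp.coeFn_sum, Finset.sum_apply, lp.coeFn_smul, Pi.smul_apply,
    smul_eq_mul, h]
  rw [Finset.sum_comm]
  simp

theorem inner_matrixUnit (Λ : Finset ℤ) (a b : Λ → Fin d) (ψ φ : ChainSpace d) :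
    inner ℂ (matrixUnit Λ a b ψ) φ = inner ℂ ψ (matrixUnit Λ b a φ) := by
  rw [lp.inner_eq_tsum, lp.inner_eq_tsum]
  have hl : ∀ s : Config d, s ∉ {s | restr Λ s = a} →
      inner ℂ ((matrixUnit Λ a b ψ : Config d → ℂ) s) (φ s) = 0 := by
    intro s hs
    have : (matrixUnit Λ a b ψ : Config d → ℂ) s = 0 := if_neg hs
    rw [this, inner_zero_left]
  have hr : ∀ s : Config d, s ∉ {s | restr Λ s = b} →
      inner ℂ (ψ s) ((matrixUnit Λ b a φ : Config d → ℂ) s) = 0 := by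
    intro s hs
    have : (matrixUnit Λ b a φ : Config d → ℂ) s = 0 := if_neg hs
    rw [this, inner_zero_right]
  rw [← tsum_subtype_eq_of_support_subset (s := {s | restr Λ s = a})
      (fun s hs => by by_contra h; exact hs (hl s h)),
    ← tsum_subtype_eq_of_support_subset (s := {s | restr Λ s = b})
      (fun s hs => by by_contra h; exact hs (hr s h))]
  let e : {s : Config d | restr Λ s = a} ≃ {s : Config d | restr Λ s = b} :=
    { toFun := fun s => ⟨overwrite Λ s.1 b, Set.mem_ofPred_eq ▸ restr_overwrite Λ s.1 b⟩
      invFun := fun s => ⟨overwrite Λ s.1 a, Set.mem_ofPred_eq ▸ restr_overwrite Λ s.1 a⟩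
      left_inv := by
        rintro ⟨s, hs⟩
        apply Subtype.ext
        simp only [overwrite_overwrite]
        rw [← (hs : restr Λ s = a), overwrite_restr]
      right_inv := by
        rintro ⟨s, hs⟩
        apply Subtype.ext
        simp only [overwrite_overwrite]
        rw [← (hs : restr Λ s = b), overwrite_restr] }
  rw [← e.tsum_eq]
  apply tsum_congr
  rintro ⟨s, hs⟩
  have hs' : restr Λ s = a := hs
  have h1 : (matrixUnit Λ a b ψ : Config d → ℂ) s = ψ (overwrite Λ s b) := if_pos hs
  have h2 : (matrixUnit Λ b a φ : Config d → ℂ) (overwrite Λ s b) = φ s := by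
    have : (matrixUnit Λ b a φ : Config d → ℂ) (overwrite Λ s b)
        = φ (overwrite Λ (overwrite Λ s b) a) := if_pos (restr_overwrite Λ s b)
    rw [this, overwrite_overwrite, ← hs', overwrite_restr]
  simp only [e, Equiv.coe_fn_mk, h1, h2]

theorem star_matrixUnit (Λ : Finset ℤ) (a b : Λ → Fin d) :
    star (matrixUnit Λ a b) = matrixUnit Λ b a := by
  rw [ContinuousLinearMap.star_eq_adjoint]
  symm
  rw [ContinuousLinearMap.eq_adjoint_iff]
  exact fun ψ φ => inner_matrixUnit Λ b a ψ φ

/-- The local algebra of a finite region `Λ`, that is the full matrix algebra over `⊗_{Λ} ℂ^d`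
(with basis indexed by `Λ → Fin d`), acting as `M ⊗ 𝟙`:
`((M ⊗ 𝟙) ψ)(s) = ∑ b, M (s|Λ) b * ψ (s with b written on Λ)`. -/
def localRep (Λ : Finset ℤ) : Matrix (Λ → Fin d) (Λ → Fin d) ℂ →⋆ₐ[ℂ] ChainOp d where
  toAlgHom := AlgHom.ofLinearMap (localLin Λ)
    (by
      ext ψ s
      rw [localLin_apply]
      simp [Matrix.one_apply, overwrite_restr])
    (by
      intro M N
      ext ψ s
      rw [localLin_apply, mul_apply_eq_comp, localLin_apply]
      simp_rw [localLin_apply, restr_overwrite, overwrite_overwrite, Matrix.mul_apply,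
        Finset.sum_mul, Finset.mul_sum, mul_assoc]
      exact Finset.sum_comm)
  map_star' M := by
    change localLin Λ (star M) = star (localLin Λ M)
    simp only [localLin, LinearMap.coe_mk, AddHom.coe_mk, star_sum, star_smul, star_matrixUnit,
      Matrix.star_apply]
    exact Finset.sum_comm

theorem localRep_apply (Λ : Finset ℤ) (M : Matrix (Λ → Fin d) (Λ → Fin d) ℂ)
    (ψ : ChainSpace d) (s : Config d) :
    (localRep Λ M ψ : Config d → ℂ) s = ∑ b, M (restr Λ s) b * ψ (overwrite Λ s b) :=
  localLin_apply Λ M ψ s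

/-- The local algebras are realised faithfully (hence isometrically). -/
theorem localRep_injective (hd : d ≠ 0) (Λ : Finset ℤ) :
    Function.Injective (localRep (d := d) Λ) := by
  classical
  rw [injective_iff_map_eq_zero]
  intro M hM
  have : Nonempty (Config d) := ⟨fun _ => ⟨0, Nat.pos_of_ne_zero hd⟩⟩
  obtain ⟨s⟩ := this
  ext a b
  have h := localRep_apply Λ M (lp.single 2 (overwrite Λ s b) (1 : ℂ)) (overwrite Λ s a)
  rw [hM] at h
  simp only [restr_overwrite, overwrite_overwrite] at h
  rw [Finset.sum_eq_single b] at h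
  · simpa using h.symm
  · intro c _ hc
    rw [lp.single_apply_ne, mul_zero]
    intro h'
    apply hc
    rw [← restr_overwrite Λ s c, h', restr_overwrite]
  · simp

/-- Tensoring with the identity: the embedding of the matrix algebra of `Λ` in that of `Λ'`. -/
def matrixEmbed {Λ Λ' : Finset ℤ} (h : Λ ⊆ Λ') (M : Matrix (Λ → Fin d) (Λ → Fin d) ℂ) :
    Matrix (Λ' → Fin d) (Λ' → Fin d) ℂ :=
  Matrix.of fun a b => if ∀ j : Λ', (j : ℤ) ∉ Λ → a j = b j then
    M (fun j => a ⟨j, h j.2⟩) (fun j => b ⟨j, h j.2⟩) else 0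

/-- The realisations of the local algebras are compatible with tensoring with the identity. -/
theorem localRep_matrixEmbed {Λ Λ' : Finset ℤ} (h : Λ ⊆ Λ')
    (M : Matrix (Λ → Fin d) (Λ → Fin d) ℂ) :
    localRep Λ' (matrixEmbed h M) = localRep Λ M := by
  classical
  ext ψ s
  rw [localRep_apply, localRep_apply]
  simp only [matrixEmbed, Matrix.of_apply, ite_mul, zero_mul]
  rw [← Finset.sum_filter]
  symm
  refine Finset.sum_bij (fun b _ => restr Λ' (overwrite Λ s b)) ?_ ?_ ?_ ?_
  · intro b _
    simp only [Finset.mem_filter, Finset.mem_univ, true_and]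
    intro j hj
    simp [restr, overwrite, hj]
  · intro b _ c _ hbc
    funext j
    have := congrFun hbc ⟨j, h j.2⟩
    simpa [restr, overwrite] using this
  · intro c hc
    simp only [Finset.mem_filter, Finset.mem_univ, true_and] at hc
    refine ⟨fun j => c ⟨j, h j.2⟩, Finset.mem_univ _, ?_⟩
    funext j
    by_cases hj : (j : ℤ) ∈ Λ
    · simp [restr, overwrite, hj]
    · simpa [restr, overwrite, hj] using hc j hj
  · intro b _
    congr 1
    · congr 1
      funext j
      simp [restr, overwrite]
    · apply congrArg (ψ : Config d → ℂ)
      funext j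
      by_cases hj : j ∈ Λ'
      · simp [restr, overwrite, hj]
      · have hj' : j ∉ Λ := fun hj' => hj (h hj')
        simp [overwrite, hj, hj']

/-! ### Quasi-local algebras -/

/-- The norm closure of the algebra generated by (that is, of the increasing union of) the local
algebras of the finite regions `Λ ⊆ S`: the C⋆-inductive limit of these local algebras. -/
def regionSubalgebra (d : ℕ) (S : Set ℤ) : StarSubalgebra ℂ (ChainOp d) :=
  (⨆ (Λ : Finset ℤ) (_ : (Λ : Set ℤ) ⊆ S), (localRep (d := d) Λ).range).topologicalClosure

/-- The quasi-local C⋆-algebra of observables in the region `S ⊆ ℤ`. -/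
def Obs (d : ℕ) (S : Set ℤ) : Type := regionSubalgebra d S

/-- An observable as an operator on `ChainSpace d`. -/
def Obs.val {S : Set ℤ} (x : Obs d S) : ChainOp d := Subtype.val x

theorem Obs.ext {S : Set ℤ} {x y : Obs d S} (h : x.val = y.val) : x = y := Subtype.ext h

instance (d : ℕ) (S : Set ℤ) : CStarAlgebra (Obs d S) :=
  StarSubalgebra.cstarAlgebra (regionSubalgebra d S)
    (h_closed := StarSubalgebra.isClosed_topologicalClosure _)

instance (d : ℕ) (S : Set ℤ) : PartialOrder (Obs d S) := CStarAlgebra.spectralOrder _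

instance (d : ℕ) (S : Set ℤ) : StarOrderedRing (Obs d S) := CStarAlgebra.spectralOrderedRing _

/-- The embedding of the observables in the bounded operators on `ChainSpace d`. -/
def valHom (d : ℕ) (S : Set ℤ) : Obs d S →⋆ₐ[ℂ] ChainOp d where
  toFun := Obs.val
  map_one' := rfl
  map_mul' _ _ := rfl
  map_zero' := rfl
  map_add' _ _ := rfl
  commutes' _ := rfl
  map_star' _ := rfl

theorem valHom_apply {S : Set ℤ} (x : Obs d S) : valHom d S x = x.val := rfl

/-- A ⋆-endomorphism of the bounded operators on `ChainSpace d` that maps the observables of `S`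
to observables of `T`, as a ⋆-homomorphism between these. -/
def homOfVal {S T : Set ℤ} (f : ChainOp d →⋆ₐ[ℂ] ChainOp d)
    (hf : ∀ x : Obs d S, f x.val ∈ regionSubalgebra d T) : Obs d S →⋆ₐ[ℂ] Obs d T :=
  let g : Obs d S → Obs d T := fun x => ⟨f x.val, hf x⟩
  have hg : ∀ x, valHom d T (g x) = f (valHom d S x) := fun _ => rfl
  have inj : ∀ {x y : Obs d T}, valHom d T x = valHom d T y → x = y := fun h => Obs.ext h
  { toFun := g
    map_one' := inj (by rw [hg, map_one, map_one, map_one])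
    map_mul' := fun x y => inj (by rw [hg, map_mul, map_mul, map_mul, hg, hg])
    map_zero' := inj (by rw [hg, map_zero, map_zero, map_zero])
    map_add' := fun x y => inj (by rw [hg, map_add, map_add, map_add, hg, hg])
    commutes' := fun c => inj (by
      rw [hg, AlgHomClass.commutes, AlgHomClass.commutes, AlgHomClass.commutes])
    map_star' := fun x => inj (by rw [hg, map_star, map_star, map_star, hg]) }

theorem val_homOfVal {S T : Set ℤ} (f : ChainOp d →⋆ₐ[ℂ] ChainOp d)
    (hf : ∀ x : Obs d S, f x.val ∈ regionSubalgebra d T) (x : Obs d S) :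
    (homOfVal f hf x).val = f x.val := rfl

/-- The right half-line `[0, ∞)`. -/
abbrev rightHalf : Set ℤ := Set.Ici 0

/-- The left half-line `(-∞, -1]`. -/
abbrev leftHalf : Set ℤ := Set.Iic (-1)

/-- The algebra `𝒜` of the two-sided infinite chain. -/
abbrev ChainAlg (d : ℕ) : Type := Obs d Set.univ

/-- The algebra `𝒜_R` of the right half-infinite chain. -/
abbrev RightAlg (d : ℕ) : Type := Obs d rightHalf

/-- The algebra `𝒜_L` of the left half-infinite chain. -/
abbrev LeftAlg (d : ℕ) : Type := Obs d leftHalf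

theorem regionSubalgebra_mono {S T : Set ℤ} (h : S ⊆ T) :
    regionSubalgebra d S ≤ regionSubalgebra d T := by
  apply StarSubalgebra.topologicalClosure_mono
  exact iSup₂_le fun Λ hΛ => le_iSup₂_of_le Λ (hΛ.trans h) le_rfl

/-- The inclusion of the observables of a region in those of a larger region. For the half-lines
it is `B ↦ B ⊗ 𝟙` on `𝒜_L`, and `A ↦ 𝟙 ⊗ A` on `𝒜_R`. -/
def incl {S T : Set ℤ} (h : S ⊆ T) : Obs d S →⋆ₐ[ℂ] Obs d T :=
  homOfVal (StarAlgHom.id ℂ (ChainOp d)) (fun x => regionSubalgebra_mono h x.2)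

theorem val_incl {S T : Set ℤ} (h : S ⊆ T) (x : Obs d S) : (incl h x).val = x.val :=
  val_homOfVal _ _ x

/-! ### The reflection -/

/-- The unitary on `ℓ²(Config d)` which reflects configurations by `j ↦ -j-1`. -/
def reflOp (d : ℕ) : ChainOp d :=
  pullbackOp (fun _ => True) (fun s j => s (-j - 1)) (by
    intro s _ t _ h
    funext j
    have := congrFun h (-j - 1)
    simpa using this)

theorem reflOp_apply (ψ : ChainSpace d) (s : Config d) :
    (reflOp d ψ : Config d → ℂ) s = ψ (fun j => s (-j - 1)) := by
  exact (pullbackOp_apply _ _ _ ψ s).trans (if_pos trivial)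

theorem reflOp_mul_self : reflOp d * reflOp d = 1 := by
  ext ψ s
  rw [mul_apply_eq_comp, reflOp_apply, reflOp_apply]
  simp

theorem star_reflOp : star (reflOp d) = reflOp d := by
  rw [ContinuousLinearMap.star_eq_adjoint]
  symm
  rw [ContinuousLinearMap.eq_adjoint_iff]
  intro ψ φ
  rw [lp.inner_eq_tsum, lp.inner_eq_tsum]
  let e : Config d ≃ Config d :=
    { toFun := fun s j => s (-j - 1)
      invFun := fun s j => s (-j - 1)
      left_inv := fun s => by simp
      right_inv := fun s => by simp }
  rw [← e.tsum_eq]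
  apply tsum_congr
  intro s
  rw [reflOp_apply, reflOp_apply]
  simp [e]

/-- Conjugation with the reflection unitary. -/
def reflConj (d : ℕ) : ChainOp d ≃⋆ₐ[ℂ] ChainOp d :=
  Unitary.conjStarAlgAut ℂ (ChainOp d) ⟨reflOp d, by
    rw [Unitary.mem_iff, star_reflOp]
    exact ⟨reflOp_mul_self, reflOp_mul_self⟩⟩

theorem reflConj_apply (T : ChainOp d) : reflConj d T = reflOp d * T * reflOp d := by
  rw [reflConj, Unitary.conjStarAlgAut_apply]
  simp [star_reflOp]

theorem reflConj_reflConj (T : ChainOp d) : reflConj d (reflConj d T) = T := by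
  rw [reflConj_apply, reflConj_apply, mul_assoc, mul_assoc, mul_assoc, reflOp_mul_self, mul_one,
    ← mul_assoc, reflOp_mul_self, one_mul]

/-- The reflection `j ↦ -j-1` of the chain. -/
def reflSite : ℤ ≃ ℤ where
  toFun j := -j - 1
  invFun j := -j - 1
  left_inv j := by simp
  right_inv j := by simp

/-- The bijection of a finite region with its mirror image. -/
def reflRegion (Λ : Finset ℤ) : (Λ.map reflSite.toEmbedding : Finset ℤ) ≃ Λ where
  toFun j := ⟨-(j : ℤ) - 1, by
    obtain ⟨i, hi, hij⟩ := Finset.mem_map.1 j.2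
    rw [← hij]
    simpa [reflSite] using hi⟩
  invFun j := ⟨-(j : ℤ) - 1, Finset.mem_map.2 ⟨j, j.2, rfl⟩⟩
  left_inv j := by simp
  right_inv j := by simp

/-- The reflection carries an observable of `Λ` to the mirrored observable of the mirror image. -/
theorem reflConj_localRep (Λ : Finset ℤ) (M : Matrix (Λ → Fin d) (Λ → Fin d) ℂ) :
    reflConj d (localRep Λ M) = localRep (Λ.map reflSite.toEmbedding)
      (Matrix.of fun a b => M (a ∘ (reflRegion Λ).symm) (b ∘ (reflRegion Λ).symm)) := by
  ext ψ s
  rw [reflConj_apply, mul_apply_eq_comp, mul_apply_eq_comp, reflOp_apply,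
    localRep_apply, localRep_apply]
  simp only [reflOp_apply, Matrix.of_apply]
  rw [← (Equiv.arrowCongr (reflRegion Λ) (Equiv.refl (Fin d))).sum_comp]
  apply Finset.sum_congr rfl
  intro b _
  congr 1
  apply congrArg (ψ : Config d → ℂ)
  funext j
  by_cases hj : j ∈ Λ.map reflSite.toEmbedding
  · have hj' : -j - 1 ∈ Λ := ((reflRegion Λ) ⟨j, hj⟩).2
    simp only [overwrite, hj, hj', dif_pos]
    simp [Equiv.arrowCongr, reflRegion]
  · have hj' : -j - 1 ∉ Λ := fun h => hj (Finset.mem_map.2 ⟨-j - 1, h, by simp [reflSite]⟩)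
    simp only [overwrite, dif_neg hj, dif_neg hj']
    simp

theorem reflConj_mem {S T : Set ℤ} (h : ∀ j ∈ S, -j - 1 ∈ T) {x : ChainOp d}
    (hx : x ∈ regionSubalgebra d S) : reflConj d x ∈ regionSubalgebra d T := by
  have hcont : Continuous (reflConj d) := by
    have : (reflConj d : ChainOp d → ChainOp d) = fun T => reflOp d * T * reflOp d :=
      funext reflConj_apply
    rw [this]
    fun_prop
  have hle : regionSubalgebra d S ≤
      (regionSubalgebra d T).comap (reflConj d : ChainOp d →⋆ₐ[ℂ] ChainOp d) := by
    apply StarSubalgebra.topologicalClosure_minimal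
    · refine iSup₂_le fun Λ hΛ => ?_
      rintro _ ⟨M, rfl⟩
      change reflConj d (localRep Λ M) ∈ regionSubalgebra d T
      rw [reflConj_localRep]
      apply StarSubalgebra.le_topologicalClosure
      have hΛ' : ((Λ.map reflSite.toEmbedding : Finset ℤ) : Set ℤ) ⊆ T := by
        intro j hj
        obtain ⟨i, hi, rfl⟩ := Finset.mem_map.1 hj
        exact h i (hΛ hi)
      exact (le_iSup₂_of_le (f := fun (Λ : Finset ℤ) (_ : (Λ : Set ℤ) ⊆ T) =>
        (localRep (d := d) Λ).range) _ hΛ' le_rfl) ⟨_, rfl⟩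
    · exact (StarSubalgebra.isClosed_topologicalClosure _).preimage hcont
  exact hle hx

/-- The reflection, restricted to the observables of a region `S` that it maps into `T`. -/
def reflHom {S T : Set ℤ} (h : ∀ j ∈ S, -j - 1 ∈ T) : Obs d S →⋆ₐ[ℂ] Obs d T :=
  homOfVal (reflConj d : ChainOp d →⋆ₐ[ℂ] ChainOp d) (fun x => reflConj_mem h x.2)

theorem val_reflHom {S T : Set ℤ} (h : ∀ j ∈ S, -j - 1 ∈ T) (x : Obs d S) :
    (reflHom h x).val = reflConj d x.val :=
  val_homOfVal _ _ x

theorem reflHom_reflHom {S T : Set ℤ} (h : ∀ j ∈ S, -j - 1 ∈ T) (h' : ∀ j ∈ T, -j - 1 ∈ S)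
    (x : Obs d S) : reflHom h' (reflHom h x) = x := by
  apply Obs.ext
  rw [val_reflHom, val_reflHom, reflConj_reflConj]

theorem refl_mem_univ : ∀ j ∈ (Set.univ : Set ℤ), -j - 1 ∈ (Set.univ : Set ℤ) :=
  fun _ _ => Set.mem_univ _

theorem refl_mem_right : ∀ j ∈ leftHalf, -j - 1 ∈ rightHalf := by
  intro j hj
  simp only [Set.mem_Iic, Set.mem_Ici] at hj ⊢
  omega

/-- The reflection automorphism `γ` of `𝒜`. -/
def γ (d : ℕ) : ChainAlg d ≃⋆ₐ[ℂ] ChainAlg d :=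
  StarAlgEquiv.ofStarAlgHom (reflHom refl_mem_univ) (reflHom refl_mem_univ)
    (StarAlgHom.ext (reflHom_reflHom refl_mem_univ refl_mem_univ))
    (StarAlgHom.ext (reflHom_reflHom refl_mem_univ refl_mem_univ))

theorem val_γ (x : ChainAlg d) : (γ d x).val = reflConj d x.val :=
  val_reflHom refl_mem_univ x

/-- The isomorphism `γ_{L → R}` of `𝒜_L` with `𝒜_R`. -/
def γLR (d : ℕ) : LeftAlg d →⋆ₐ[ℂ] RightAlg d :=
  reflHom refl_mem_right

/-- The inclusion `B ↦ B ⊗ 𝟙` of `𝒜_L` in `𝒜`. -/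
def inclL (d : ℕ) : LeftAlg d →⋆ₐ[ℂ] ChainAlg d := incl (Set.subset_univ _)

/-- The inclusion `A ↦ 𝟙 ⊗ A` of `𝒜_R` in `𝒜`. -/
def inclR (d : ℕ) : RightAlg d →⋆ₐ[ℂ] ChainAlg d := incl (Set.subset_univ _)

/-- The relation `γ (B ⊗ 𝟙) = 𝟙 ⊗ γ_{L → R} B`. -/
theorem γ_inclL (B : LeftAlg d) : γ d (inclL d B) = inclR d (γLR d B) := by
  apply Obs.ext
  rw [val_γ, inclL, val_incl, inclR, val_incl, γLR, val_reflHom]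

/-- The observable `Q^{(j)}`: the matrix `Q` at the site `j`. -/
def siteObs (j : ℤ) (Q : Matrix (Fin d) (Fin d) ℂ) : ChainAlg d :=
  ⟨localRep {j} (Matrix.of fun a b => Q (a ⟨j, by simp⟩) (b ⟨j, by simp⟩)),
    StarSubalgebra.le_topologicalClosure _
      ((le_iSup₂_of_le (f := fun (Λ : Finset ℤ) (_ : (Λ : Set ℤ) ⊆ Set.univ) =>
        (localRep (d := d) Λ).range) {j} (Set.subset_univ _) le_rfl) ⟨_, rfl⟩)⟩

/-- The relation `γ (Q^{(j)}) = Q^{(-j-1)}` that characterises `γ`. -/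
theorem γ_siteObs (j : ℤ) (Q : Matrix (Fin d) (Fin d) ℂ) :
    γ d (siteObs j Q) = siteObs (-j - 1) Q := by
  apply Obs.ext
  rw [val_γ]
  exact reflConj_localRep {j} _

/-! ### States -/

/-- A pure state: a normalised positive functional such that every positive functional majorised
by it is a multiple of it. -/
def IsPureState {A : Type*} [CStarAlgebra A] [PartialOrder A] [StarOrderedRing A]
    (ω : A →ₚ[ℂ] ℂ) : Prop :=
  ω 1 = 1 ∧ ∀ φ : A →ₚ[ℂ] ℂ, (∀ a, 0 ≤ a → φ a ≤ ω a) →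
    ∃ t : ℝ, 0 ≤ t ∧ t ≤ 1 ∧ ∀ a, φ a = t * ω a

/-- `ω ∘ γ = ω`. -/
def IsReflectionInvariant (ω : ChainAlg d →ₚ[ℂ] ℂ) : Prop := ∀ a, ω (γ d a) = ω a

/-- The restriction of a positive functional on `𝒜` to `𝒜_R`. -/
def restrictRight (ω : ChainAlg d →ₚ[ℂ] ℂ) : RightAlg d →ₚ[ℂ] ℂ :=
  ω.comp (PositiveLinearMap.ofClass (inclR d))

/-- The von Neumann algebra `N''` generated by a ⋆-algebra `N` of bounded operators. -/
def bicommutant {H : Type*} [NormedAddCommGroup H] [InnerProductSpace ℂ H] [CompleteSpace H]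
    (N : StarSubalgebra ℂ (H →L[ℂ] H)) : VonNeumannAlgebra H where
  toStarSubalgebra := StarSubalgebra.centralizer ℂ
    (StarSubalgebra.centralizer ℂ (N : Set (H →L[ℂ] H)) : Set (H →L[ℂ] H))
  centralizer_centralizer' := by simp

theorem coe_bicommutant {H : Type*} [NormedAddCommGroup H] [InnerProductSpace ℂ H]
    [CompleteSpace H] (N : StarSubalgebra ℂ (H →L[ℂ] H)) :
    (bicommutant N : Set (H →L[ℂ] H)) =
      Set.centralizer (Set.centralizer (N : Set (H →L[ℂ] H))) := by
  change ((StarSubalgebra.centralizer ℂ (StarSubalgebra.centralizer ℂ (N : Set (H →L[ℂ] H)) :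
    Set (H →L[ℂ] H)) : StarSubalgebra ℂ (H →L[ℂ] H)) : Set (H →L[ℂ] H)) = _
  rw [StarSubalgebra.coe_centralizer_centralizer]
  have : star (N : Set (H →L[ℂ] H)) = N := by
    ext x
    simp
  rw [this, Set.union_self]

/-- A type I factor: the centre is `ℂ 𝟙`, and there is a nonzero abelian projection `p`, that is
one for which `p M p` is commutative. -/
def IsTypeIFactor {H : Type*} [NormedAddCommGroup H] [InnerProductSpace ℂ H] [CompleteSpace H]
    (M : VonNeumannAlgebra H) : Prop :=
  (∀ x ∈ M, x ∈ M.commutant → ∃ c : ℂ, x = c • (1 : H →L[ℂ] H)) ∧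
  ∃ p ∈ M, IsStarProjection p ∧ p ≠ 0 ∧
    ∀ x ∈ M, ∀ y ∈ M, (p * x * p) * (p * y * p) = (p * y * p) * (p * x * p)

/-- The von Neumann algebra `π_φ(A)''` generated by the GNS representation of `φ` is a type I
factor. -/
def IsTypeIFactorFunctional {A : Type*} [CStarAlgebra A] [PartialOrder A] [StarOrderedRing A]
    (φ : A →ₚ[ℂ] ℂ) : Prop :=
  IsTypeIFactor (bicommutant (H := φ.GNS) (StarAlgHom.range φ.gnsStarAlgHom))

/-- The split property: the von Neumann algebra generated by the GNS representation of the
restriction to `𝒜_R` is a type I factor. -/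
def HasSplitProperty (ω : ChainAlg d →ₚ[ℂ] ℂ) : Prop :=
  IsTypeIFactorFunctional (restrictRight ω)

/-! ### Representations -/

/-- `(H, π, Ω)` is a GNS triple of the functional `φ`: `Ω` is cyclic and `φ = ⟨Ω, π(·) Ω⟩`. -/
def IsGNSTriple {A : Type*} [CStarAlgebra A] [PartialOrder A] [StarOrderedRing A]
    {H : Type*} [NormedAddCommGroup H] [InnerProductSpace ℂ H] [CompleteSpace H]
    (φ : A →ₚ[ℂ] ℂ) (π : A →⋆ₐ[ℂ] (H →L[ℂ] H)) (Ω : H) : Prop :=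
  DenseRange (fun a => π a Ω) ∧ ∀ a, φ a = inner ℂ Ω (π a Ω)

/-- A representation on a nonzero Hilbert space is irreducible if its only closed invariant
subspaces are the trivial ones. -/
def IsIrreducible {A : Type*} [CStarAlgebra A]
    {H : Type*} [NormedAddCommGroup H] [InnerProductSpace ℂ H] [CompleteSpace H]
    (π : A →⋆ₐ[ℂ] (H →L[ℂ] H)) : Prop :=
  Nontrivial H ∧ ∀ K : Submodule ℂ H, IsClosed (K : Set H) →
    (∀ a, ∀ v ∈ K, π a v ∈ K) → K = ⊥ ∨ K = ⊤

/-- The Hilbert space tensor product `H ⊗ H`. -/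
abbrev HTensor (H : Type*) [NormedAddCommGroup H] [InnerProductSpace ℂ H] : Type _ :=
  UniformSpace.Completion (H ⊗[ℂ] H)

/-- The elementary tensor `ξ ⊗ η` in the Hilbert space tensor product. -/
def vecTensor {H : Type*} [NormedAddCommGroup H] [InnerProductSpace ℂ H] (ξ η : H) : HTensor H :=
  ((ξ ⊗ₜ[ℂ] η : H ⊗[ℂ] H) : UniformSpace.Completion (H ⊗[ℂ] H))

/-- The bounded operator `x ⊗ y` on the Hilbert space tensor product. -/
def opTensor {H : Type*} [NormedAddCommGroup H] [InnerProductSpace ℂ H] (x y : H →L[ℂ] H) :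
    HTensor H →L[ℂ] HTensor H :=
  (TensorProduct.mapL x y).completion

theorem opTensor_vecTensor {H : Type*} [NormedAddCommGroup H] [InnerProductSpace ℂ H]
    (x y : H →L[ℂ] H) (ξ η : H) :
    opTensor x y (vecTensor ξ η) = vecTensor (x ξ) (y η) := by
  simp [opTensor, vecTensor]

/-- `πHat` is the representation `(π ∘ γ_{L → R}) ⊗ π` of `𝒜 = 𝒜_L ⊗ 𝒜_R` on `H ⊗ H`. The linear
span of the products `B ⊗ A` is dense in `𝒜`, so that `πHat` is determined by `π`. -/
def IsDoubling {H : Type*} [NormedAddCommGroup H] [InnerProductSpace ℂ H] [CompleteSpace H]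
    (π : RightAlg d →⋆ₐ[ℂ] (H →L[ℂ] H))
    (πHat : ChainAlg d →⋆ₐ[ℂ] (HTensor H →L[ℂ] HTensor H)) : Prop :=
  ∀ (B : LeftAlg d) (A : RightAlg d),
    πHat (inclL d B * inclR d A) = opTensor (π (γLR d B)) (π A)

/-- `(H, π, Ω, Γ)` is a reflection-split representation associated to `ω`, where `πHat` is
`(π ∘ γ_{L → R}) ⊗ π`. -/
structure IsReflectionSplitRep
    {H : Type*} [NormedAddCommGroup H] [InnerProductSpace ℂ H] [CompleteSpace H]
    (ω : ChainAlg d →ₚ[ℂ] ℂ) (π : RightAlg d →⋆ₐ[ℂ] (H →L[ℂ] H))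
    (πHat : ChainAlg d →⋆ₐ[ℂ] (HTensor H →L[ℂ] HTensor H)) (Ω : HTensor H)
    (Γ : unitary (HTensor H →L[ℂ] HTensor H)) : Prop where
  doubling : IsDoubling π πHat
  irreducible : IsIrreducible π
  norm_eq_one : ‖Ω‖ = 1
  gns : IsGNSTriple ω πHat Ω
  implements : ∀ A : ChainAlg d,
    (Γ : HTensor H →L[ℂ] HTensor H) (πHat A Ω) = πHat (γ d A) Ω

/-- `Γ (ξ ⊗ η) = σ (η ⊗ ξ)` for all `ξ`, `η`. -/
def ActsAsSignedFlip {H : Type*} [NormedAddCommGroup H] [InnerProductSpace ℂ H] [CompleteSpace H]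
    (Γ : unitary (HTensor H →L[ℂ] HTensor H)) (σ : ℤˣ) : Prop :=
  ∀ ξ η : H,
    (Γ : HTensor H →L[ℂ] HTensor H) (vecTensor ξ η) = ((σ : ℤ) : ℂ) • vecTensor η ξ

end SpinChain

end

open scoped ComplexOrder TensorProduct InnerProductSpace

noncomputable section

namespace SpinChain

/-! ### Schur's lemma -/

section Schur

variable {A : Type*} [CStarAlgebra A]
  {H : Type*} [NormedAddCommGroup H] [InnerProductSpace ℂ H] [CompleteSpace H]

/-! Both `Γ` and the flip `F` of `H ⊗ H` implement the reflection `γ` in `πHat`. For `Γ` this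
follows from its defining relation on the dense orbit of the cyclic vector. For `F` it follows from
the symmetric form of `πHat`, which puts the same `π` on both factors. Hence `F Γ` commutes with the
images of both half-chains, and Schur's lemma for `H ⊗ H` gives `Γ = c F`. Since `γ² = 1`, also `Γ²
= 1`, so `c² = 1` and `c` is a sign. Conjugation by a signed flip then exchanges the two tensor
factors.

Schur's lemma for `H ⊗ H` is reduced to the one for `H` by slicing: a matrix element in the left
factor of an operator commuting with `𝟙 ⊗ π` commutes with `π`, hence is scalar. Using this in both
factors leaves only scalars.

For independence of the choice, two representations of the same state are related by a unitary `W`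
that intertwines the doublings and carries `Ω` to `Ω'`. A nonzero slice `U` of `W` intertwines `π`
and `π'`, and Schur's lemma makes `W` proportional to `U ⊗ U`. Therefore `W` intertwines the flips.
It also carries `Γ` to `Γ'`, so the signs agree. -/

theorem IsIrreducible.eq_zero_of_mul_eq_zero {π : A →⋆ₐ[ℂ] (H →L[ℂ] H)} (hπ : IsIrreducible π)
    {S T : H →L[ℂ] H} (hS : ∀ a, Commute (π a) S) (hST : S * T = 0) : S = 0 ∨ T = 0 := by
  -- The kernel of `S` is closed and invariant, so it is trivial or everything; it also contains the
  -- range of `T`.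
  have hinv : ∀ a, ∀ v ∈ LinearMap.ker S.toLinearMap, π a v ∈ LinearMap.ker S.toLinearMap := by
    intro a v hv
    have hv' : S v = 0 := hv
    have h : π a (S v) = S (π a v) := congrArg (fun R : H →L[ℂ] H => R v) (hS a).eq
    change S (π a v) = 0
    rw [← h, hv', map_zero]
  rcases hπ.2 _ S.isClosed_ker hinv with h | h
  · right
    ext v
    have hv : T v ∈ LinearMap.ker S.toLinearMap := congrArg (fun R : H →L[ℂ] H => R v) hST
    rw [h] at hv
    exact hv
  · left
    ext v
    have hv : v ∈ LinearMap.ker S.toLinearMap := h ▸ Submodule.mem_top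
    exact hv

/-- The spectrum of `T` is a single point. Two distinct spectral values would be separated by two
continuous functions with product zero, and the functional calculus would turn these into nonzero
elements of the commutant with product zero. Continuous functions take the place of spectral
projections here. -/
theorem IsIrreducible.exists_eq_smul_one_of_isSelfAdjoint {π : A →⋆ₐ[ℂ] (H →L[ℂ] H)}
    (hπ : IsIrreducible π) {T : H →L[ℂ] H} (hsa : IsSelfAdjoint T)
    (hT : ∀ a, Commute (π a) T) : ∃ c : ℂ, T = c • (1 : H →L[ℂ] H) := by
  have := hπ.1
  have hsub : ∀ x ∈ spectrum ℝ T, ∀ y ∈ spectrum ℝ T, ¬ x < y := by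
    intro x hx y hy hxy
    have hcomm : ∀ f : ℝ → ℝ, ∀ a, Commute (π a) (cfc f T) :=
      fun f a => ((hT a).symm.cfc_real f).symm
    -- The two ramps are supported on opposite sides of the midpoint of `x` and `y`; the first is
    -- positive at `x`, the second at `y`.
    have hmul : cfc (fun t : ℝ => max 0 ((x + y) / 2 - t)) T *
        cfc (fun t : ℝ => max 0 (t - (x + y) / 2)) T = 0 := by
      rw [← cfc_mul _ _ T (by fun_prop) (by fun_prop)]
      rw [← cfc_zero (R := ℝ) (a := T)]
      congr 1
      funext t
      rcases le_total t ((x + y) / 2) with h | h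
      · simp [h]
      · simp [h]
    -- By spectral mapping `f z` is a spectral value of `cfc f T`, whereas the zero operator has
    -- spectrum `{0}`.
    have hne : ∀ f : ℝ → ℝ, Continuous f → ∀ z ∈ spectrum ℝ T, f z ≠ 0 → cfc f T ≠ 0 := by
      intro f hf z hz hfz h0
      have hmem : f z ∈ spectrum ℝ (cfc f T) := by
        rw [cfc_map_spectrum f T]
        exact ⟨z, hz, rfl⟩
      rw [h0, spectrum.zero_eq] at hmem
      exact hfz hmem
    rcases hπ.eq_zero_of_mul_eq_zero (hcomm _) hmul with h | h
    · refine hne _ (by fun_prop) x hx ?_ h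
      rw [max_eq_right (by linarith)]
      linarith
    · refine hne _ (by fun_prop) y hy ?_ h
      rw [max_eq_right (by linarith)]
      linarith
  obtain ⟨x, hx⟩ : (spectrum ℝ T).Nonempty :=
    ContinuousFunctionalCalculus.spectrum_nonempty T hsa
  refine ⟨x, ?_⟩
  calc T = cfc (fun t : ℝ => t) T := (cfc_id' ℝ T).symm
    _ = cfc (fun _ : ℝ => x) T := cfc_congr fun y hy =>
      le_antisymm (not_lt.1 (hsub x hx y hy)) (not_lt.1 (hsub y hy x hx))
    _ = (x : ℂ) • 1 := by
      rw [cfc_const x T, Algebra.algebraMap_eq_smul_one]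
      rfl

/-- **Schur's lemma**: the commutant of an irreducible representation consists of scalars. -/
theorem IsIrreducible.exists_eq_smul_one {π : A →⋆ₐ[ℂ] (H →L[ℂ] H)} (hπ : IsIrreducible π)
    {T : H →L[ℂ] H} (hT : ∀ a, Commute (π a) T) : ∃ c : ℂ, T = c • (1 : H →L[ℂ] H) := by
  -- The commutant is closed under the adjoint, so the self-adjoint case applies to the real and
  -- imaginary parts of `T`.
  have hT' : ∀ a, Commute (π a) (star T) := by
    intro a
    have h := (hT (star a)).star_star
    rwa [← map_star, star_star] at h
  obtain ⟨r, hr⟩ := hπ.exists_eq_smul_one_of_isSelfAdjoint (realPart T).2 (fun a => by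
    rw [realPart_apply_coe]
    exact ((hT a).add_right (hT' a)).smul_right _)
  obtain ⟨s, hs⟩ := hπ.exists_eq_smul_one_of_isSelfAdjoint (imaginaryPart T).2 (fun a => by
    rw [imaginaryPart_apply_coe]
    exact (((hT a).sub_right (hT' a)).smul_right _).smul_right _)
  refine ⟨r + Complex.I * s, ?_⟩
  calc T = (realPart T : H →L[ℂ] H) + Complex.I • (imaginaryPart T : H →L[ℂ] H) :=
      (realPart_add_I_smul_imaginaryPart T).symm
    _ = _ := by rw [hr, hs, add_smul, mul_smul]

end Schur

/-! ### Operators on the Hilbert space tensor product -/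

section Tensor

variable {H H' : Type*} [NormedAddCommGroup H] [InnerProductSpace ℂ H]
  [NormedAddCommGroup H'] [InnerProductSpace ℂ H']

theorem inner_vecTensor (ξ η ξ' η' : H) :
    ⟪vecTensor ξ η, vecTensor ξ' η'⟫_ℂ = ⟪ξ, ξ'⟫_ℂ * ⟪η, η'⟫_ℂ := by
  rw [vecTensor, vecTensor, UniformSpace.Completion.inner_coe, TensorProduct.inner_tmul]

theorem continuousLinearMap_ext_vecTensor {E : Type*} [NormedAddCommGroup E] [NormedSpace ℂ E]
    {S T : HTensor H →L[ℂ] E} (h : ∀ ξ η, S (vecTensor ξ η) = T (vecTensor ξ η)) : S = T := by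
  ext z
  induction z using UniformSpace.Completion.induction_on with
  | hp => exact isClosed_eq S.continuous T.continuous
  | ih z =>
    induction z using TensorProduct.induction_on with
    | zero => rw [UniformSpace.Completion.coe_zero, map_zero, map_zero]
    | tmul ξ η => exact h ξ η
    | add x y hx hy => rw [UniformSpace.Completion.coe_add, map_add, map_add, hx, hy]

theorem ext_inner_vecTensor {z w : HTensor H}
    (h : ∀ ξ η, ⟪z, vecTensor ξ η⟫_ℂ = ⟪w, vecTensor ξ η⟫_ℂ) : z = w := by
  have : innerSL ℂ z = innerSL ℂ w := continuousLinearMap_ext_vecTensor h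
  exact (innerSL_inj).1 this

/-- The operator `U ⊗ U` between the Hilbert space tensor squares. -/
def mapTensor (U : H →L[ℂ] H') : HTensor H →L[ℂ] HTensor H' :=
  (TensorProduct.mapL U U).completion

theorem mapTensor_vecTensor (U : H →L[ℂ] H') (ξ η : H) :
    mapTensor U (vecTensor ξ η) = vecTensor (U ξ) (U η) := by
  simp [mapTensor, vecTensor]

/-- The flip `ξ ⊗ η ↦ η ⊗ ξ`. -/
def flip (H : Type*) [NormedAddCommGroup H] [InnerProductSpace ℂ H] :
    HTensor H →L[ℂ] HTensor H :=
  ((TensorProduct.commIsometry ℂ H H).toLinearIsometry.toContinuousLinearMap).completion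

theorem flip_vecTensor (ξ η : H) : flip H (vecTensor ξ η) = vecTensor η ξ := by
  simp [flip, vecTensor]

theorem flip_mul_flip : flip H * flip H = 1 :=
  continuousLinearMap_ext_vecTensor fun ξ η => by simp [flip_vecTensor]

theorem flip_ne_zero [Nontrivial H] : flip H ≠ 0 := by
  intro h
  obtain ⟨e, he⟩ := exists_ne (0 : H)
  have h0 : vecTensor e e = 0 := by rw [← flip_vecTensor, h]; rfl
  have h1 := inner_vecTensor e e e e
  rw [h0, inner_zero_left] at h1
  simp [he] at h1

theorem flip_mul_opTensor (x y : H →L[ℂ] H) : flip H * opTensor x y = opTensor y x * flip H :=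
  continuousLinearMap_ext_vecTensor fun ξ η => by simp [flip_vecTensor, opTensor_vecTensor]

theorem mapTensor_comp_flip (U : H →L[ℂ] H') :
    mapTensor U ∘L flip H = flip H' ∘L mapTensor U :=
  continuousLinearMap_ext_vecTensor fun ξ η => by simp [flip_vecTensor, mapTensor_vecTensor]

/-- The map `η ↦ ξ ⊗ η`. -/
def insertLeft (ξ : H) : H →L[ℂ] HTensor H :=
  UniformSpace.Completion.toComplL ∘L TensorProduct.mkL ℂ H H ξ

theorem insertLeft_apply (ξ η : H) : insertLeft ξ η = vecTensor ξ η := rfl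

theorem opTensor_comp_insertLeft (x : H →L[ℂ] H) (ξ : H) :
    opTensor 1 x ∘L insertLeft ξ = insertLeft ξ ∘L x := by
  ext η
  simp [insertLeft_apply, opTensor_vecTensor]

/-! ### Slices in the left factor, and Schur's lemma on the tensor square. -/

variable [CompleteSpace H']

theorem adjoint_insertLeft_vecTensor (ξ ξ' η' : H') :
    ContinuousLinearMap.adjoint (insertLeft ξ) (vecTensor ξ' η') = ⟪ξ, ξ'⟫_ℂ • η' := by
  refine ext_inner_left ℂ fun η => ?_
  rw [ContinuousLinearMap.adjoint_inner_right, insertLeft_apply, inner_vecTensor,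
    inner_smul_right]

theorem adjoint_insertLeft_comp_opTensor (x : H' →L[ℂ] H') (ξ : H') :
    ContinuousLinearMap.adjoint (insertLeft ξ) ∘L opTensor 1 x =
      x ∘L ContinuousLinearMap.adjoint (insertLeft ξ) :=
  continuousLinearMap_ext_vecTensor fun ξ' η' => by
    simp [opTensor_vecTensor, adjoint_insertLeft_vecTensor]

/-- The slice of `T` in the left tensor factor, with matrix elements
`⟨η', (slice ξ' T ξ) η⟩ = ⟨ξ' ⊗ η', T (ξ ⊗ η)⟩`. -/
def slice (ξ' : H') (T : HTensor H →L[ℂ] HTensor H') (ξ : H) : H →L[ℂ] H' :=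
  ContinuousLinearMap.adjoint (insertLeft ξ') ∘L T ∘L insertLeft ξ

theorem inner_slice (ξ' η' : H') (T : HTensor H →L[ℂ] HTensor H') (ξ η : H) :
    ⟪η', slice ξ' T ξ η⟫_ℂ = ⟪vecTensor ξ' η', T (vecTensor ξ η)⟫_ℂ := by
  simp [slice, ContinuousLinearMap.adjoint_inner_right, insertLeft_apply]

/-- The slices carry all matrix elements of `T` between elementary tensors, and these determine `T`.
-/
theorem eq_zero_of_slice_eq_zero {T : HTensor H →L[ℂ] HTensor H'}
    (h : ∀ ξ' ξ, slice ξ' T ξ = 0) : T = 0 := by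
  refine continuousLinearMap_ext_vecTensor fun ξ η => ext_inner_vecTensor fun ξ' η' => ?_
  rw [← inner_conj_symm, ← inner_slice, h]
  simp

/-- Inserting a vector on the left intertwines `x` with `𝟙 ⊗ x`, and so does the adjoint of the
insertion. Thus an intertwining relation in the right factor descends from `T` to each slice, where
irreducibility on a single factor can be used. -/
theorem slice_comp {T : HTensor H →L[ℂ] HTensor H'} {x : H →L[ℂ] H} {x' : H' →L[ℂ] H'}
    (h : T ∘L opTensor 1 x = opTensor 1 x' ∘L T) (ξ' : H') (ξ : H) :
    slice ξ' T ξ ∘L x = x' ∘L slice ξ' T ξ := by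
  simp only [slice, ContinuousLinearMap.comp_assoc]
  rw [← opTensor_comp_insertLeft, ← ContinuousLinearMap.comp_assoc T, h,
    ContinuousLinearMap.comp_assoc, ← ContinuousLinearMap.comp_assoc,
    adjoint_insertLeft_comp_opTensor, ContinuousLinearMap.comp_assoc]

variable [CompleteSpace H]

/-- For irreducible `π`, the commutant of `π ⊗ 𝟙` and `𝟙 ⊗ π` consists of scalars. -/
theorem IsIrreducible.exists_eq_smul_one_of_commute_opTensor {A : Type*} [CStarAlgebra A]
    {π : A →⋆ₐ[ℂ] (H →L[ℂ] H)} (hπ : IsIrreducible π) {T : HTensor H →L[ℂ] HTensor H}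
    (hl : ∀ a, Commute (opTensor (π a) 1) T) (hr : ∀ a, Commute (opTensor 1 (π a)) T) :
    ∃ c : ℂ, T = c • (1 : HTensor H →L[ℂ] HTensor H) := by
  have := hπ.1
  have slice_scalar : ∀ S : HTensor H →L[ℂ] HTensor H, (∀ a, Commute (opTensor 1 (π a)) S) →
      ∀ ξ' ξ, ∃ c : ℂ, ∀ η' η, ⟪vecTensor ξ' η', S (vecTensor ξ η)⟫_ℂ = c * ⟪η', η⟫_ℂ := by
    intro S hS ξ' ξ
    obtain ⟨c, hc⟩ := hπ.exists_eq_smul_one (T := slice ξ' S ξ)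
      (fun a => (slice_comp (hS a).symm.eq ξ' ξ).symm)
    refine ⟨c, fun η' η => ?_⟩
    rw [← inner_slice, hc]
    simp
  -- Conjugation by the flip turns commutation with `π ⊗ 𝟙` into commutation with `𝟙 ⊗ π`, so the
  -- slicing argument also covers the left factor.
  have hflip : ∀ a, Commute (opTensor 1 (π a)) (flip H * T * flip H) := by
    intro a
    change opTensor 1 (π a) * (flip H * T * flip H) = flip H * T * flip H * opTensor 1 (π a)
    rw [← mul_assoc, ← mul_assoc, ← flip_mul_opTensor, mul_assoc (flip H), (hl a).eq,
      mul_assoc _ (flip H) (opTensor _ _), flip_mul_opTensor]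
    simp only [mul_assoc]
  have inner_flip : ∀ z w : HTensor H, ⟪flip H z, w⟫_ℂ = ⟪z, flip H w⟫_ℂ := by
    have h : ContinuousLinearMap.adjoint (flip H) = flip H := by
      refine continuousLinearMap_ext_vecTensor fun ξ η => ext_inner_vecTensor fun ξ' η' => ?_
      rw [ContinuousLinearMap.adjoint_inner_left, flip_vecTensor, flip_vecTensor,
        inner_vecTensor, inner_vecTensor, mul_comm]
    intro z w
    rw [← ContinuousLinearMap.adjoint_inner_right, h]
  choose f hf using slice_scalar T hr
  choose g hg using slice_scalar _ hflip
  -- Both sides equal the matrix element of `T` between `ξ' ⊗ η'` and `ξ ⊗ η`, sliced on the left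
  -- and on the right respectively.
  have hfg : ∀ ξ' ξ η' η, f ξ' ξ * ⟪η', η⟫_ℂ = g η' η * ⟪ξ', ξ⟫_ℂ := by
    intro ξ' ξ η' η
    rw [← hf, ← hg]
    change _ = ⟪_, flip H (T (flip H _))⟫_ℂ
    rw [← inner_flip, flip_vecTensor, flip_vecTensor]
  obtain ⟨e, he⟩ := exists_norm_eq H (zero_le_one (α := ℝ))
  have hee : ⟪e, e⟫_ℂ = 1 := by simp [inner_self_eq_norm_sq_to_K, he]
  -- Setting `η' = η = e` in `hfg` gives `f ξ' ξ = g e e * ⟪ξ', ξ⟫`, so `T` has the matrix elements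
  -- of the scalar `g e e`.
  refine ⟨g e e, continuousLinearMap_ext_vecTensor fun ξ η =>
    ext_inner_vecTensor fun ξ' η' => ?_⟩
  rw [← inner_conj_symm, ← inner_conj_symm _ (vecTensor ξ' η')]
  congr 1
  have h := hfg ξ' ξ e e
  rw [hee, mul_one] at h
  rw [hf, h]
  simp [inner_smul_right, inner_vecTensor, mul_assoc]

theorem ActsAsSignedFlip.coe_eq {Γ : unitary (HTensor H →L[ℂ] HTensor H)} {σ : ℤˣ}
    (h : ActsAsSignedFlip Γ σ) :
    (Γ : HTensor H →L[ℂ] HTensor H) = ((σ : ℤ) : ℂ) • flip H :=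
  continuousLinearMap_ext_vecTensor fun ξ η => by simp [h ξ η, flip_vecTensor]

theorem actsAsSignedFlip_of_coe_eq {Γ : unitary (HTensor H →L[ℂ] HTensor H)} {σ : ℤˣ}
    (h : (Γ : HTensor H →L[ℂ] HTensor H) = ((σ : ℤ) : ℂ) • flip H) : ActsAsSignedFlip Γ σ :=
  fun ξ η => by simp [h, flip_vecTensor]

theorem ActsAsSignedFlip.unique [Nontrivial H] {Γ : unitary (HTensor H →L[ℂ] HTensor H)}
    {σ τ : ℤˣ} (hσ : ActsAsSignedFlip Γ σ) (hτ : ActsAsSignedFlip Γ τ) : σ = τ := by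
  have h := smul_left_injective ℂ (flip_ne_zero (H := H)) (hσ.coe_eq.symm.trans hτ.coe_eq)
  exact Units.ext (by exact_mod_cast h)

end Tensor

/-! ### Reflection-split representations -/

section ReflectionSplit

variable {d : ℕ}

theorem γLR_surjective : Function.Surjective (γLR d) := fun A =>
  have h : ∀ j ∈ rightHalf, -j - 1 ∈ leftHalf := by
    intro j hj
    simp only [Set.mem_Iic, Set.mem_Ici] at hj ⊢
    omega
  ⟨reflHom h A, reflHom_reflHom h refl_mem_right A⟩

theorem γ_γ (A : ChainAlg d) : γ d (γ d A) = A :=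
  reflHom_reflHom refl_mem_univ refl_mem_univ A

/-! ### The doubled representation and the flip. -/

section Doubling

variable {H : Type*} [NormedAddCommGroup H] [InnerProductSpace ℂ H] [CompleteSpace H]
  {π : RightAlg d →⋆ₐ[ℂ] (H →L[ℂ] H)}
  {πHat : ChainAlg d →⋆ₐ[ℂ] (HTensor H →L[ℂ] HTensor H)}

theorem IsDoubling.inclR (h : IsDoubling π πHat) (A : RightAlg d) :
    πHat (inclR d A) = opTensor 1 (π A) := by
  simpa using h 1 A

theorem IsDoubling.inclL (h : IsDoubling π πHat) (B : LeftAlg d) :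
    πHat (inclL d B) = opTensor (π (γLR d B)) 1 := by
  simpa using h B 1

/-- As `γLR` is onto, the images of the two half-chains are exactly the operators `π a ⊗ 𝟙` and `𝟙 ⊗
π a`. -/
theorem IsDoubling.exists_eq_smul_one (h : IsDoubling π πHat) (hπ : IsIrreducible π)
    {T : HTensor H →L[ℂ] HTensor H}
    (hl : ∀ B : LeftAlg d, Commute (πHat (SpinChain.inclL d B)) T)
    (hr : ∀ A : RightAlg d, Commute (πHat (SpinChain.inclR d A)) T) :
    ∃ c : ℂ, T = c • (1 : HTensor H →L[ℂ] HTensor H) := by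
  refine hπ.exists_eq_smul_one_of_commute_opTensor (fun A => ?_) (fun A => h.inclR A ▸ hr A)
  obtain ⟨B, rfl⟩ := γLR_surjective A
  exact h.inclL B ▸ hl B

/-- The flip implements `γ`, because the doubling uses the same `π` in both factors. The two
half-chains suffice for the commutant argument. -/
theorem IsDoubling.flip_mul_γ_inclL (h : IsDoubling π πHat) (B : LeftAlg d) :
    flip H * πHat (γ d (SpinChain.inclL d B)) = πHat (SpinChain.inclL d B) * flip H := by
  rw [γ_inclL, h.inclR, h.inclL, flip_mul_opTensor]

theorem IsDoubling.flip_mul_γ_inclR (h : IsDoubling π πHat) (A : RightAlg d) :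
    flip H * πHat (γ d (SpinChain.inclR d A)) = πHat (SpinChain.inclR d A) * flip H := by
  obtain ⟨B, rfl⟩ := γLR_surjective A
  -- The right observable is the reflection of a left one, so `γ² = 1` brings it back to the left
  -- half-chain.
  rw [← γ_inclL, γ_γ, γ_inclL, h.inclR, h.inclL, flip_mul_opTensor]

end Doubling

/-! ### The implementing unitary is a signed flip. -/

section Rep

variable {H : Type*} [NormedAddCommGroup H] [InnerProductSpace ℂ H] [CompleteSpace H]
  {ω : ChainAlg d →ₚ[ℂ] ℂ} {π : RightAlg d →⋆ₐ[ℂ] (H →L[ℂ] H)}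
  {πHat : ChainAlg d →⋆ₐ[ℂ] (HTensor H →L[ℂ] HTensor H)} {Ω : HTensor H}
  {Γ : unitary (HTensor H →L[ℂ] HTensor H)}

/-- Both sides are continuous and agree on the dense orbit of `Ω`, by multiplicativity of `γ`. -/
theorem IsReflectionSplitRep.mul_πHat (h : IsReflectionSplitRep ω π πHat Ω Γ) (A : ChainAlg d) :
    (Γ : HTensor H →L[ℂ] HTensor H) * πHat A = πHat (γ d A) * Γ := by
  refine DFunLike.coe_injective (h.gns.1.equalizer (ContinuousLinearMap.continuous _)
    (ContinuousLinearMap.continuous _) (funext fun X => ?_))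
  have h1 := h.implements (A * X)
  rw [map_mul, map_mul, map_mul] at h1
  change (Γ : HTensor H →L[ℂ] HTensor H) (πHat A (πHat X Ω)) =
    πHat (γ d A) ((Γ : HTensor H →L[ℂ] HTensor H) (πHat X Ω))
  rw [h.implements]
  exact h1

theorem IsReflectionSplitRep.mul_self (h : IsReflectionSplitRep ω π πHat Ω Γ) :
    (Γ : HTensor H →L[ℂ] HTensor H) * Γ = 1 := by
  refine DFunLike.coe_injective (h.gns.1.equalizer (ContinuousLinearMap.continuous _)
    (ContinuousLinearMap.continuous _) (funext fun X => ?_))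
  change (Γ : HTensor H →L[ℂ] HTensor H) ((Γ : HTensor H →L[ℂ] HTensor H) (πHat X Ω)) = πHat X Ω
  rw [h.implements, h.implements, γ_γ]

/-- The reflection is implemented by the flip up to a sign. -/
theorem IsReflectionSplitRep.exists_actsAsSignedFlip (h : IsReflectionSplitRep ω π πHat Ω Γ) :
    ∃ σ : ℤˣ, ActsAsSignedFlip Γ σ := by
  have := h.irreducible.1
  -- `Γ` and the flip both implement the involution `γ`, so their product commutes with both
  -- half-chains.
  obtain ⟨c, hc⟩ := h.doubling.exists_eq_smul_one h.irreducible
    (T := flip H * (Γ : HTensor H →L[ℂ] HTensor H))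
    (fun B => by
      change _ * (_ * _) = _ * _ * _
      rw [mul_assoc, h.mul_πHat, ← mul_assoc, ← mul_assoc, h.doubling.flip_mul_γ_inclL])
    (fun A => by
      change _ * (_ * _) = _ * _ * _
      rw [mul_assoc, h.mul_πHat, ← mul_assoc, ← mul_assoc, h.doubling.flip_mul_γ_inclR])
  have hΓ : (Γ : HTensor H →L[ℂ] HTensor H) = c • flip H := by
    calc (Γ : HTensor H →L[ℂ] HTensor H) = flip H * (flip H * Γ) := by
          rw [← mul_assoc, flip_mul_flip, one_mul]
      _ = c • flip H := by rw [hc, mul_smul_comm, mul_one]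
  have hne : (1 : HTensor H →L[ℂ] HTensor H) ≠ 0 := fun h0 =>
    flip_ne_zero (H := H) (by rw [← mul_one (flip H), h0, mul_zero])
  -- Both `Γ` and the flip square to the identity.
  have hcc : c * c = 1 := by
    have h1 := h.mul_self
    rw [hΓ, smul_mul_smul_comm, flip_mul_flip] at h1
    exact smul_left_injective ℂ hne (h1.trans (one_smul ℂ _).symm)
  rcases mul_self_eq_one_iff.1 hcc with rfl | rfl
  · exact ⟨1, actsAsSignedFlip_of_coe_eq (by simpa using hΓ)⟩
  · exact ⟨-1, actsAsSignedFlip_of_coe_eq (by simpa using hΓ)⟩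

theorem IsReflectionSplitRep.conj_opTensor (h : IsReflectionSplitRep ω π πHat Ω Γ)
    (x : H →L[ℂ] H) :
    (Γ : HTensor H →L[ℂ] HTensor H) * opTensor 1 x * star (Γ : HTensor H →L[ℂ] HTensor H) =
      opTensor x 1 := by
  obtain ⟨σ, hσ⟩ := h.exists_actsAsSignedFlip
  have h1 : (Γ : HTensor H →L[ℂ] HTensor H) * opTensor 1 x = opTensor x 1 * Γ := by
    rw [hσ.coe_eq, smul_mul_assoc, flip_mul_opTensor, mul_smul_comm]
  rw [h1, mul_assoc, Unitary.mul_star_self_of_mem Γ.2, mul_one]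

end Rep

/-- Two GNS triples of the same functional are unitarily equivalent. -/
theorem IsGNSTriple.exists_linearIsometryEquiv {A : Type*} [CStarAlgebra A] [PartialOrder A]
    [StarOrderedRing A] {K K' : Type*} [NormedAddCommGroup K] [InnerProductSpace ℂ K]
    [CompleteSpace K] [NormedAddCommGroup K'] [InnerProductSpace ℂ K'] [CompleteSpace K']
    {φ : A →ₚ[ℂ] ℂ} {ρ : A →⋆ₐ[ℂ] (K →L[ℂ] K)} {ρ' : A →⋆ₐ[ℂ] (K' →L[ℂ] K')} {Ω : K} {Ω' : K'}
    (h : IsGNSTriple φ ρ Ω) (h' : IsGNSTriple φ ρ' Ω') :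
    ∃ W : K ≃ₗᵢ[ℂ] K', ∀ a, W (ρ a Ω) = ρ' a Ω' := by
  let orbit : A →ₗ[ℂ] K := (ContinuousLinearMap.apply ℂ K Ω).toLinearMap ∘ₗ ρ.toAlgHom.toLinearMap
  let orbit' : A →ₗ[ℂ] K' :=
    (ContinuousLinearMap.apply ℂ K' Ω').toLinearMap ∘ₗ ρ'.toAlgHom.toLinearMap
  -- Both squared norms equal `φ (star a * a)`, so the correspondence of the two dense orbits is
  -- isometric and extends.
  have hnorm : ∀ a, ‖ρ' a Ω'‖ = ‖ρ a Ω‖ := by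
    intro a
    have h1 : ⟪ρ' a Ω', ρ' a Ω'⟫_ℂ = ⟪ρ a Ω, ρ a Ω⟫_ℂ := by
      rw [← ContinuousLinearMap.adjoint_inner_right, ← ContinuousLinearMap.adjoint_inner_right,
        ← ContinuousLinearMap.star_eq_adjoint, ← ContinuousLinearMap.star_eq_adjoint,
        ← map_star, ← map_star, ← mul_apply_eq_comp, ← mul_apply_eq_comp, ← map_mul, ← map_mul,
        ← h.2, ← h'.2]
    rw [norm_eq_sqrt_re_inner (𝕜 := ℂ), norm_eq_sqrt_re_inner (𝕜 := ℂ), h1]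
  refine ⟨(LinearEquiv.refl ℂ A).extendOfIsometry orbit orbit' h.1 h'.1 hnorm, fun a => ?_⟩
  exact LinearEquiv.extendOfIsometry_eq (f := LinearEquiv.refl ℂ A) (e₁ := orbit) (e₂ := orbit')
    h.1 h'.1 hnorm a

/-! ### Independence of the sign from the representation. -/

section Independence

variable {H H' : Type*} [NormedAddCommGroup H] [InnerProductSpace ℂ H] [CompleteSpace H]
  [NormedAddCommGroup H'] [InnerProductSpace ℂ H'] [CompleteSpace H']
  {ω : ChainAlg d →ₚ[ℂ] ℂ} {π : RightAlg d →⋆ₐ[ℂ] (H →L[ℂ] H)}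
  {πHat : ChainAlg d →⋆ₐ[ℂ] (HTensor H →L[ℂ] HTensor H)} {Ω : HTensor H}
  {Γ : unitary (HTensor H →L[ℂ] HTensor H)}
  {π' : RightAlg d →⋆ₐ[ℂ] (H' →L[ℂ] H')}
  {πHat' : ChainAlg d →⋆ₐ[ℂ] (HTensor H' →L[ℂ] HTensor H')} {Ω' : HTensor H'}
  {Γ' : unitary (HTensor H' →L[ℂ] HTensor H')}

/-- If `W` is an invertible intertwiner of two doublings, then it is a multiple of `U ⊗ U` for an
intertwiner `U` of the irreducible representations. In particular it intertwines the flips. -/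
theorem IsDoubling.comp_flip (h : IsDoubling π πHat) (hπ : IsIrreducible π)
    (h' : IsDoubling π' πHat') (W : HTensor H ≃ₗᵢ[ℂ] HTensor H')
    (hW : ∀ A z, W (πHat A z) = πHat' A (W z)) (z : HTensor H) :
    W (flip H z) = flip H' (W z) := by
  have := hπ.1
  let W₁ : HTensor H →L[ℂ] HTensor H' := W.toLinearIsometry.toContinuousLinearMap
  let V : HTensor H' →L[ℂ] HTensor H := W.symm.toLinearIsometry.toContinuousLinearMap
  have hV : ∀ A z, V (πHat' A z) = πHat A (V z) := by
    intro A z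
    apply W.injective
    change W (W.symm _) = W (πHat A (W.symm z))
    rw [hW, W.apply_symm_apply, W.apply_symm_apply]
  have hW₁ : W₁ ≠ 0 := by
    intro h0
    refine flip_ne_zero (H := H) (ContinuousLinearMap.ext fun z => W.injective ?_)
    have h1 : ∀ z, W z = 0 := fun z => congrArg (fun T : HTensor H →L[ℂ] HTensor H' => T z) h0
    rw [h1, h1]
  -- Any nonzero slice of `W` serves as `U`. It need not be normalised to a unitary: only the
  -- symmetry of `U ⊗ U` under the flips is needed.
  obtain ⟨ξ', ξ, hU⟩ : ∃ ξ' ξ, slice ξ' W₁ ξ ≠ 0 := by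
    by_contra! h0
    exact hW₁ (eq_zero_of_slice_eq_zero h0)
  set U := slice ξ' W₁ ξ
  have hUπ : ∀ A v, U (π A v) = π' A (U v) := by
    intro A v
    have h1 : W₁ ∘L opTensor 1 (π A) = opTensor 1 (π' A) ∘L W₁ := by
      rw [← h.inclR, ← h'.inclR]
      exact ContinuousLinearMap.ext (hW _)
    exact congrArg (fun T : H →L[ℂ] H' => T v) (slice_comp h1 ξ' ξ)
  have hUUl : ∀ (B : LeftAlg d), mapTensor U ∘L πHat (SpinChain.inclL d B) =
      πHat' (SpinChain.inclL d B) ∘L mapTensor U := by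
    intro B
    rw [h.inclL, h'.inclL]
    exact continuousLinearMap_ext_vecTensor fun ξ η => by
      simp [opTensor_vecTensor, mapTensor_vecTensor, hUπ]
  have hUUr : ∀ (A : RightAlg d), mapTensor U ∘L πHat (SpinChain.inclR d A) =
      πHat' (SpinChain.inclR d A) ∘L mapTensor U := by
    intro A
    rw [h.inclR, h'.inclR]
    exact continuousLinearMap_ext_vecTensor fun ξ η => by
      simp [opTensor_vecTensor, mapTensor_vecTensor, hUπ]
  -- `W⁻¹ (U ⊗ U)` is an endomorphism of the doubling, hence a scalar by Schur's lemma.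
  have hcomm : ∀ X, mapTensor U ∘L πHat X = πHat' X ∘L mapTensor U →
      Commute (πHat X) (V ∘L mapTensor U) := by
    intro X hX
    ext z
    change πHat X (V (mapTensor U z)) = V (mapTensor U (πHat X z))
    rw [← hV]
    exact congrArg V (congrArg (fun T : HTensor H →L[ℂ] HTensor H' => T z) hX).symm
  obtain ⟨c, hc⟩ := h.exists_eq_smul_one hπ (fun B => hcomm _ (hUUl B))
    (fun A => hcomm _ (hUUr A))
  have hUW : ∀ z, mapTensor U z = c • W z := by
    intro z
    have h1 : V (mapTensor U z) = c • z :=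
      congrArg (fun T : HTensor H →L[ℂ] HTensor H => T z) hc
    rw [← map_smul, ← h1]
    exact (W.apply_symm_apply _).symm
  -- Otherwise `U v ⊗ U v` would vanish for a vector with `U v ≠ 0`, against the product formula for
  -- its norm.
  have hc0 : c ≠ 0 := by
    rintro rfl
    obtain ⟨v, hv⟩ := DFunLike.ne_iff.1 hU
    have h1 : vecTensor (U v) (U v) = 0 := by
      rw [← mapTensor_vecTensor, hUW, zero_smul]
    have h2 := inner_vecTensor (U v) (U v) (U v) (U v)
    rw [h1, inner_zero_left] at h2
    exact hv (by simpa using h2)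
  have h1 : mapTensor U (flip H z) = flip H' (mapTensor U z) :=
    congrArg (fun T : HTensor H →L[ℂ] HTensor H' => T z) (mapTensor_comp_flip U)
  rw [hUW, hUW, map_smul] at h1
  exact smul_right_injective _ hc0 h1

/-- The sign does not depend on the reflection-split representation. -/
theorem IsReflectionSplitRep.actsAsSignedFlip_of (h : IsReflectionSplitRep ω π πHat Ω Γ)
    (h' : IsReflectionSplitRep ω π' πHat' Ω' Γ') {σ : ℤˣ} (hσ : ActsAsSignedFlip Γ σ) :
    ActsAsSignedFlip Γ' σ := by
  obtain ⟨W, hW⟩ := h.gns.exists_linearIsometryEquiv h'.gns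
  have intertwines : ∀ A z, W (πHat A z) = πHat' A (W z) := by
    intro A
    refine congrFun (h.gns.1.equalizer (W.continuous.comp (πHat A).continuous)
      ((πHat' A).continuous.comp W.continuous) (funext fun X => ?_))
    have h1 := hW (A * X)
    rw [map_mul, map_mul] at h1
    change W (πHat A (πHat X Ω)) = πHat' A (W (πHat X Ω))
    rw [hW]
    exact h1
  have hflip := h.doubling.comp_flip h.irreducible h'.doubling W intertwines
  refine actsAsSignedFlip_of_coe_eq (DFunLike.coe_injective
    (h'.gns.1.equalizer (ContinuousLinearMap.continuous _)
      (ContinuousLinearMap.continuous _) (funext fun X => ?_)))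
  change (Γ' : HTensor H' →L[ℂ] HTensor H') (πHat' X Ω') =
    ((σ : ℤ) : ℂ) • flip H' (πHat' X Ω')
  -- On the orbit, `Γ' W = W Γ = σ W F = σ F' W`, with `F` and `F'` the two flips.
  rw [h'.implements, ← hW, ← h.implements, hσ.coe_eq, ← hW, ← hflip, ← map_smul]
  rfl

end Independence

end ReflectionSplit

end SpinChain

end

theorem theorem2p6 {d : ℕ} (hd : 2 ≤ d)
    (ω : SpinChain.ChainAlg d →ₚ[ℂ] ℂ) (hpure : SpinChain.IsPureState ω)
    (hrefl : SpinChain.IsReflectionInvariant ω) (hsplit : SpinChain.HasSplitProperty ω)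
    {H : Type u} [NormedAddCommGroup H] [InnerProductSpace ℂ H] [CompleteSpace H]
    (π : SpinChain.RightAlg d →⋆ₐ[ℂ] (H →L[ℂ] H))
    (πHat : SpinChain.ChainAlg d →⋆ₐ[ℂ] (SpinChain.HTensor H →L[ℂ] SpinChain.HTensor H))
    (Ω : SpinChain.HTensor H) (Γ : unitary (SpinChain.HTensor H →L[ℂ] SpinChain.HTensor H))
    (hrep : SpinChain.IsReflectionSplitRep ω π πHat Ω Γ) :
    (∀ x : H →L[ℂ] H,
      (Γ : SpinChain.HTensor H →L[ℂ] SpinChain.HTensor H) * SpinChain.opTensor 1 x *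
        star (Γ : SpinChain.HTensor H →L[ℂ] SpinChain.HTensor H) = SpinChain.opTensor x 1) ∧
    (∃! σ : ℤˣ, SpinChain.ActsAsSignedFlip Γ σ) ∧
    (∀ (H' : Type v) [NormedAddCommGroup H'] [InnerProductSpace ℂ H'] [CompleteSpace H']
      (π' : SpinChain.RightAlg d →⋆ₐ[ℂ] (H' →L[ℂ] H'))
      (πHat' : SpinChain.ChainAlg d →⋆ₐ[ℂ] (SpinChain.HTensor H' →L[ℂ] SpinChain.HTensor H'))
      (Ω' : SpinChain.HTensor H') (Γ' : unitary (SpinChain.HTensor H' →L[ℂ] SpinChain.HTensor H')),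
      SpinChain.IsReflectionSplitRep ω π' πHat' Ω' Γ' →
        ∀ σ : ℤˣ, SpinChain.ActsAsSignedFlip Γ σ ↔ SpinChain.ActsAsSignedFlip Γ' σ) := by
  refine ⟨hrep.conj_opTensor, ?_, fun H' _ _ _ π' πHat' Ω' Γ' hrep' σ =>
    ⟨hrep.actsAsSignedFlip_of hrep', hrep'.actsAsSignedFlip_of hrep⟩⟩
  -- Uniqueness of the sign needs `H` to be nonzero, so that the flip is nonzero; irreducibility
  -- includes this.
  have := hrep.irreducible.1
  obtain ⟨σ, hσ⟩ := hrep.exists_actsAsSignedFlip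
  exact ⟨σ, hσ, fun τ hτ => hτ.unique hσ⟩
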